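/- A graphon is a symmetric measurable function $W:[0,1]^2\to[0,1]$; two graphons are identified if they are equal almost everywhere, and $\lambda$ denotes Lebesgue measure. Let $F$ be a finite simple graph with vertex set $\{1,\ldots,m\}$ that has at least one edge, let $0<p\le 1$, and let $\alpha_1,\ldots,\alpha_m>0$ satisfy $\sum_{i=1}^m\alpha_i\le 1$. (i) If $(\alpha_1,\ldots,\alpha_m)\neq(1/m,\ldots,1/m)$, then $\widetilde{\mathcal P}(F,\alpha_1,\ldots,\alpha_m)$ is a quasi-random property; that is, the constant graphon $W=p$ is, up to equality almost everywhere, the unique graphon $W$ such that $$\frac1{m!}\sum_{\sigma\in S_m}\int_{A_{\sigma(1)}\times\cdots\times A_{\sigma(m)}}\ \prod_{\{i,j\}\in E(F)}W(x_i,x_j)\,dx_1\cdots dx_m=p^{|E(F)|}\prod_{i=1}^m\alpha_i$$ for all pairwise disjoint measurable sets $A_1,\ldots,A_m\subseteq[0,1]$ with $\lambda(A_i)=\alpha_i$ for every $i$. (ii) If $\sum_{i=1}^m\alpha_i<1$, then $\mathcal P(F,\alpha_1,\ldots,\alpha_m)$ is a quasi-random property; that is, the constant graphon $W=p$ is, up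 to equality almost everywhere, the unique graphon $W$ such that $$\int_{A_1\times\cdots\times A_m}\ \prod_{\{i,j\}\in E(F)}W(x_i,x_j)\,dx_1\cdots dx_m=p^{|E(F)|}\prod_{i=1}^m\alpha_i$$ for all pairwise disjoint measurable sets $A_1,\ldots,A_m\subseteq[0,1]$ with $\lambda(A_i)=\alpha_i$ for every $i$. -/

import Mathlib

open MeasureTheory

/-- A graphon: a symmetric measurable function `W : [0,1]² → [0,1]`. The interval `[0,1]` is the
subtype `unitInterval`, whose `volume` is Lebesgue measure. -/
structure Graphon where
  /-- The underlying function. -/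
  toFun : unitInterval → unitInterval → ℝ
  symm' : ∀ x y, toFun x y = toFun y x
  measurable' : Measurable (Function.uncurry toFun)
  nonneg' : ∀ x y, 0 ≤ toFun x y
  le_one' : ∀ x y, toFun x y ≤ 1

namespace Graphon

/-- `W = p` almost everywhere on `[0,1]²`. -/
def EqConst (W : Graphon) (p : ℝ) : Prop :=
  ∀ᵐ z : unitInterval × unitInterval, W.toFun z.1 z.2 = p

/-- The value `W(x_i, x_j)` at an unordered pair `{i, j}` of vertices
(well defined because `W` is symmetric). -/
def edgeWeight (W : Graphon) {m : ℕ} (x : Fin m → unitInterval) : Sym2 (Fin m) → ℝ :=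
  Sym2.lift ⟨fun i j => W.toFun (x i) (x j), fun i j => W.symm' (x i) (x j)⟩

/-- The function `x ↦ ∏_{ij ∈ E(F)} W(x_i, x_j)` on `[0,1]^m`; each edge is counted once. -/
def edgeProd (W : Graphon) {m : ℕ} (F : SimpleGraph (Fin m)) [DecidableRel F.Adj]
    (x : Fin m → unitInterval) : ℝ :=
  ∏ e ∈ F.edgeFinset, W.edgeWeight x e

end Graphon

/-- `A_1, …, A_m` are pairwise disjoint measurable subsets of `[0,1]` of measures
`α_1, …, α_m` respectively. -/
structure IsDisjointFamily {m : ℕ} (α : Fin m → ℝ) (A : Fin m → Set unitInterval) : Prop where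
  measurableSet : ∀ i, MeasurableSet (A i)
  disjoint : Pairwise fun i j => Disjoint (A i) (A j)
  measure_eq : ∀ i, volume (A i) = ENNReal.ofReal (α i)

/-- The graphon `W` satisfies `∫_{A_1 × ⋯ × A_m} ∏_{ij ∈ E(F)} W(x_i, x_j) dx = p^{|E(F)|} ∏ α_i`
for all disjoint `A_1, …, A_m` of respective measures `α_1, …, α_m`. -/
def SatisfiesP {m : ℕ} (F : SimpleGraph (Fin m)) [DecidableRel F.Adj] (α : Fin m → ℝ) (p : ℝ)
    (W : Graphon) : Prop :=
  ∀ A : Fin m → Set unitInterval, IsDisjointFamily α A →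
    ∫ x in Set.univ.pi A, W.edgeProd F x = p ^ F.edgeFinset.card * ∏ i, α i

/-- The symmetrized condition: `W` satisfies
`(1/m!) ∑_σ ∫_{A_{σ(1)} × ⋯ × A_{σ(m)}} ∏_{ij ∈ E(F)} W(x_i, x_j) dx = p^{|E(F)|} ∏ α_i`
for all disjoint `A_1, …, A_m` of respective measures `α_1, …, α_m`. -/
def SatisfiesPTilde {m : ℕ} (F : SimpleGraph (Fin m)) [DecidableRel F.Adj] (α : Fin m → ℝ) (p : ℝ)
    (W : Graphon) : Prop :=
  ∀ A : Fin m → Set unitInterval, IsDisjointFamily α A →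
    (1 / (m.factorial : ℝ)) * ∑ σ : Equiv.Perm (Fin m),
        ∫ x in Set.univ.pi (fun i => A (σ i)), W.edgeProd F x
      = p ^ F.edgeFinset.card * ∏ i, α i

/-- `P(F, α_1, …, α_m)` is a quasi-random property (for the density `p`): up to equality almost
everywhere, `W = p` is the unique graphon satisfying the condition. -/
def IsQuasiRandomP {m : ℕ} (F : SimpleGraph (Fin m)) [DecidableRel F.Adj] (α : Fin m → ℝ)
    (p : ℝ) : Prop :=
  ∀ W : Graphon, SatisfiesP F α p W ↔ W.EqConst p

/-- The symmetrized property `P̃(F, α_1, …, α_m)` is a quasi-random property (for the density `p`):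
up to equality almost everywhere, `W = p` is the unique graphon satisfying the symmetrized
condition. -/
def IsQuasiRandomPTilde {m : ℕ} (F : SimpleGraph (Fin m)) [DecidableRel F.Adj] (α : Fin m → ℝ)
    (p : ℝ) : Prop :=
  ∀ W : Graphon, SatisfiesPTilde F α p W ↔ W.EqConst p

/-! ### Additive set functions on the unit interval dominated by Lebesgue measure -/

/-! A constant graphon satisfies both identities by direct integration; uniqueness is the content.
Both properties say that a bounded function `f` on the cube, namely the edge product (summed over
permutations of the coordinates in the symmetrized case) minus a constant, has integral zero over
every box with disjoint sides of measures `α i`.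

The integral is additive in each side and bounded by a multiple of its measure. If the sides leave
room in the interval, small pieces of one side can be exchanged for pieces of the free space, so
vanishing at the measure `α i` forces vanishing on all subsets of the available space
(`eq_zero_of_forall_measure_eq`). Treating the sides one by one reaches all disjoint boxes with
smaller sides, and these determine `f` almost everywhere, so `f = 0`. If `∑ α i = 1` there is no
room, and two sides of different measures are varied together: for symmetric `f` the integral is
symmetric and biadditive in them, and `biadditive_eq_zero_of_partition` allows one of them to be
halved, which restores room.

It remains to deduce `W = p` from an almost everywhere constant symmetrized product
(`eqConst_of_ae_sum_edgeProd_eq`). Vertices are sent to a point `∞` along an ultrafilter finer than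
the almost everywhere filter. With zero, one and two vertices left in the interval, the identity has
a single unknown weight, in turn `c`, `w y` and `W x y`, all other weights being already `p`. Since
the weights are nonnegative, the sum is strictly monotone in the unknown, which must therefore be
`p`. -/

/-- Intermediate value theorem for the 1-Lipschitz function `t ↦ λ(T ∩ [0, t])`. -/
theorem exists_subset_measureReal_eq {T : Set unitInterval} (hT : MeasurableSet T) {b : ℝ}
    (hb0 : 0 ≤ b) (hb : b ≤ volume.real T) :
    ∃ B ⊆ T, MeasurableSet B ∧ volume.real B = b := by
  set g : unitInterval → ℝ := fun t => volume.real (T ∩ Set.Iic t) with hg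
  have hlip : LipschitzWith 1 g := by
    refine LipschitzWith.of_le_add fun x y => ?_
    have hsub : T ∩ Set.Iic x ⊆ (T ∩ Set.Iic y) ∪ Set.uIcc y x := by
      rintro z ⟨hzT, hzx⟩
      rcases le_total z y with h | h
      · exact Or.inl ⟨hzT, h⟩
      · exact Or.inr (Set.Icc_subset_uIcc ⟨h, hzx⟩)
    have hu : volume.real (Set.uIcc y x) = dist x y := by
      rw [Measure.real, unitInterval.volume_uIcc, edist_dist, ENNReal.toReal_ofReal dist_nonneg]
    calc g x ≤ volume.real ((T ∩ Set.Iic y) ∪ Set.uIcc y x) := measureReal_mono hsub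
      _ ≤ g y + dist x y := by rw [← hu]; exact measureReal_union_le _ _
  have h0 : g 0 = 0 := by
    have : volume.real (T ∩ Set.Iic (0 : unitInterval)) ≤ volume.real (Set.Iic (0 : unitInterval)) :=
      measureReal_mono Set.inter_subset_right
    refine le_antisymm (this.trans ?_) measureReal_nonneg
    simp [Measure.real, unitInterval.volume_Iic]
  have h1 : g 1 = volume.real T := by
    have : Set.Iic (1 : unitInterval) = Set.univ := Set.eq_univ_of_forall fun x => unitInterval.le_one x
    simp [hg, this]
  obtain ⟨t, ht⟩ := mem_range_of_exists_le_of_exists_ge hlip.continuous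
    ⟨0, h0.le.trans hb0⟩ ⟨1, hb.trans h1.ge⟩
  exact ⟨T ∩ Set.Iic t, Set.inter_subset_left, hT.inter measurableSet_Iic, ht⟩

/-- A finitely additive function of measurable sets, bounded by a multiple of the measure. -/
structure IsDominatedAdditive (τ : Set unitInterval → ℝ) : Prop where
  add : ∀ B B', MeasurableSet B → MeasurableSet B' → Disjoint B B' → τ (B ∪ B') = τ B + τ B'
  bound : ∃ C, 0 ≤ C ∧ ∀ B, MeasurableSet B → |τ B| ≤ C * volume.real B

namespace IsDominatedAdditive

variable {τ : Set unitInterval → ℝ}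

theorem sub {τ' : Set unitInterval → ℝ} (h : IsDominatedAdditive τ)
    (h' : IsDominatedAdditive τ') : IsDominatedAdditive fun B => τ B - τ' B where
  add B B' hB hB' hd := by rw [h.add B B' hB hB' hd, h'.add B B' hB hB' hd]; ring
  bound := by
    obtain ⟨C, hC0, hC⟩ := h.bound
    obtain ⟨C', hC0', hC'⟩ := h'.bound
    refine ⟨C + C', by positivity, fun B hB => (abs_sub _ _).trans ?_⟩
    rw [add_mul]
    exact add_le_add (hC B hB) (hC' B hB)

theorem const_mul_measure (κ : ℝ) : IsDominatedAdditive fun B => κ * volume.real B where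
  add B B' _ hB' hd := by rw [measureReal_union hd hB']; ring
  bound := ⟨|κ|, abs_nonneg κ, fun B _ => by
    rw [abs_mul, abs_of_nonneg (measureReal_nonneg (μ := volume) (s := B))]⟩

theorem eq_zero_of_measure (h : IsDominatedAdditive τ) {B : Set unitInterval}
    (hB : MeasurableSet B) (h0 : volume.real B = 0) : τ B = 0 := by
  obtain ⟨C, -, hC⟩ := h.bound
  simpa [h0] using hC B hB

theorem add_diff (h : IsDominatedAdditive τ) {B T : Set unitInterval} (hB : MeasurableSet B)
    (hT : MeasurableSet T) (hBT : B ⊆ T) : τ T = τ B + τ (T \ B) := by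
  rw [← h.add B (T \ B) hB (hT.diff hB) Set.disjoint_sdiff_right, Set.union_sdiff_cancel hBT]

/-- Cut `T` into `n + 1` pieces of equal measure: they share one value of `τ`, and these values sum
to `τ T = 0`, so each is zero. Stripping such pieces from `B` leaves a remainder of measure at most
`t / (n + 1)`, and domination gives the claim as `n → ∞`. -/
theorem eq_zero_of_equidistributed (h : IsDominatedAdditive τ) {T : Set unitInterval}
    (hT : MeasurableSet T) {b₀ : ℝ} (hb₀ : 0 < b₀)
    (heq : ∀ B B', MeasurableSet B → MeasurableSet B' → B ⊆ T → B' ⊆ T → Disjoint B B' →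
      volume.real B = volume.real B' → volume.real B ≤ b₀ → τ B = τ B')
    (h0 : τ T = 0) {B : Set unitInterval} (hB : MeasurableSet B) (hBT : B ⊆ T) : τ B = 0 := by
  set t := volume.real T with ht
  have htnn : 0 ≤ t := measureReal_nonneg
  have piece : ∀ n : ℕ, t / (n + 1) ≤ b₀ → ∀ B, MeasurableSet B → B ⊆ T →
      volume.real B = t / (n + 1) → τ B = 0 := by
    intro n hn B hB hBT hBm
    have key : ∀ k : ℕ, ∀ S, MeasurableSet S → S ⊆ T → Disjoint B S →
        volume.real S = k * (t / (n + 1)) → τ S = k * τ B := by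
      intro k
      induction k with
      | zero => intro S hS _ _ hSm; simpa using h.eq_zero_of_measure hS (by simpa using hSm)
      | succ k ih =>
        intro S hS hST hd hSm
        push_cast at hSm ⊢
        have hq : 0 ≤ t / (n + 1 : ℝ) := by positivity
        obtain ⟨S', hS'S, hS', hS'm⟩ := exists_subset_measureReal_eq hS hq
          (by rw [hSm]; nlinarith [mul_nonneg (Nat.cast_nonneg (α := ℝ) k) hq])
        rw [h.add_diff hS' hS hS'S, ih (S \ S') (hS.diff hS') (Set.sdiff_subset.trans hST)
          (hd.mono_right Set.sdiff_subset) (by rw [measureReal_sdiff hS'S hS', hSm, hS'm]; ring),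
          ← heq B S' hB hS' hBT (hS'S.trans hST) (hd.mono_right hS'S) (by rw [hBm, hS'm])
            (by rw [hBm]; exact hn)]
        ring
    have := key n (T \ B) (hT.diff hB) Set.sdiff_subset Set.disjoint_sdiff_right
      (by rw [measureReal_sdiff hBT hB, hBm, ← ht]; field_simp; ring)
    rw [h.add_diff hB hT hBT, this] at h0
    have h1 : ((n : ℝ) + 1) * τ B = 0 := by linarith
    exact (mul_eq_zero.1 h1).resolve_left (by positivity)
  obtain ⟨C, hC0, hC⟩ := h.bound
  have small : ∀ n : ℕ, t / (n + 1) ≤ b₀ → |τ B| ≤ C * (t / (n + 1)) := by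
    intro n hn
    have hq : 0 ≤ t / (n + 1 : ℝ) := by positivity
    have key : ∀ k : ℕ, ∀ B, MeasurableSet B → B ⊆ T → volume.real B ≤ k * (t / (n + 1)) →
        |τ B| ≤ C * (t / (n + 1)) := by
      intro k
      induction k with
      | zero =>
        intro B hB _ hBm
        refine (hC B hB).trans (mul_le_mul_of_nonneg_left (hBm.trans ?_) hC0)
        simpa using hq
      | succ k ih =>
        intro B hB hBT hBm
        push_cast at hBm
        rcases le_total (volume.real B) (t / (n + 1)) with hle | hle
        · exact (hC B hB).trans (mul_le_mul_of_nonneg_left hle hC0)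
        · obtain ⟨B', hB'B, hB', hB'm⟩ := exists_subset_measureReal_eq hB hq hle
          rw [h.add_diff hB' hB hB'B, piece n hn B' hB' (hB'B.trans hBT) hB'm, zero_add]
          exact ih _ (hB.diff hB') (Set.sdiff_subset.trans hBT)
            (by rw [measureReal_sdiff hB'B hB', hB'm]; linarith)
    refine key (n + 1) B hB hBT ((measureReal_mono hBT).trans_eq ?_)
    push_cast
    field_simp
    exact ht.symm
  have hlim : Filter.Tendsto (fun n : ℕ => t / ((n : ℝ) + 1)) Filter.atTop (nhds 0) :=
    tendsto_const_div_atTop_nhds_zero_nat t |>.comp (Filter.tendsto_add_atTop_nat 1) |>.congr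
      fun n => by simp
  have hle : |τ B| ≤ C * 0 := ge_of_tendsto (hlim.const_mul C)
    ((hlim.eventually (ge_mem_nhds hb₀)).mono fun n hn => small n hn)
  simpa using hle

/-- Two disjoint small sets of equal measure can be completed by the same `C` to sets of measure
`a`, so `τ` agrees on them. Hence `τ` is a multiple of the measure on `T`, and its value on one set
of measure `a` shows that the multiple is zero. -/
theorem eq_zero_of_forall_measure_eq (h : IsDominatedAdditive τ) {T : Set unitInterval}
    (hT : MeasurableSet T) {a : ℝ} (ha : 0 < a) (haT : a < volume.real T)
    (hA : ∀ A, MeasurableSet A → A ⊆ T → volume.real A = a → τ A = 0)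
    {B : Set unitInterval} (hB : MeasurableSet B) (hBT : B ⊆ T) : τ B = 0 := by
  have ht : 0 < volume.real T := ha.trans haT
  set κ := τ T / volume.real T with hκ
  have h' := h.sub (const_mul_measure κ)
  have hzero : ∀ B, MeasurableSet B → B ⊆ T → τ B = κ * volume.real B := by
    intro B hB hBT
    -- The bound `a` makes the measure of `C` nonnegative; the bound `volume.real T - a` leaves room
    -- for `C` outside `B ∪ B'`.
    refine sub_eq_zero.1 (h'.eq_zero_of_equidistributed hT
      (b₀ := min a (volume.real T - a)) (lt_min ha (by linarith)) ?_ ?_ hB hBT)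
    · intro B B' hB hB' hBT hB'T hd heq hle
      have h1 := hle.trans (min_le_left _ _)
      have h2 := hle.trans (min_le_right _ _)
      have hm : volume.real (T \ (B ∪ B')) = volume.real T - 2 * volume.real B := by
        rw [measureReal_sdiff (Set.union_subset hBT hB'T) (hB.union hB'), measureReal_union hd hB',
          ← heq]
        ring
      obtain ⟨C, hCs, hC, hCm⟩ := exists_subset_measureReal_eq (hT.diff (hB.union hB'))
        (b := a - volume.real B) (by linarith) (by rw [hm]; linarith)
      have hCT : C ⊆ T := hCs.trans Set.sdiff_subset
      have hdC : Disjoint C (B ∪ B') := Set.disjoint_sdiff_left.mono_left hCs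
      have hdB := (Set.disjoint_union_right.1 hdC).1
      have hdB' := (Set.disjoint_union_right.1 hdC).2
      have e1 := hA (C ∪ B) (hC.union hB) (Set.union_subset hCT hBT)
        (by rw [measureReal_union hdB hB, hCm]; ring)
      have e2 := hA (C ∪ B') (hC.union hB') (Set.union_subset hCT hB'T)
        (by rw [measureReal_union hdB' hB', hCm, ← heq]; ring)
      rw [h.add C B hC hB hdB] at e1
      rw [h.add C B' hC hB' hdB'] at e2
      simp only [heq]
      linarith
    · rw [hκ]
      field_simp
      simp
  obtain ⟨A, hAT, hAm, hAa⟩ := exists_subset_measureReal_eq hT ha.le haT.le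
  have h1 := hA A hAm hAT hAa
  rw [hzero A hAm hAT, hAa] at h1
  rw [hzero B hB hBT, (mul_eq_zero.1 h1).resolve_right ha.ne', zero_mul]

theorem eq_mul_of_forall_measure_eq (h : IsDominatedAdditive τ) {T : Set unitInterval}
    (hT : MeasurableSet T) {a c : ℝ} (ha : 0 < a) (haT : a < volume.real T)
    (hA : ∀ A, MeasurableSet A → A ⊆ T → volume.real A = a → τ A = c)
    {B : Set unitInterval} (hB : MeasurableSet B) (hBT : B ⊆ T) :
    τ B = c / a * volume.real B := by
  refine sub_eq_zero.1 ((h.sub (const_mul_measure (c / a))).eq_zero_of_forall_measure_eq hT ha haT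
    (fun A hAm hAT hAa => ?_) hB hBT)
  simp only [hA A hAm hAT hAa, hAa]
  field_simp
  simp

end IsDominatedAdditive

/-- A symmetric biadditive function which vanishes on all partitions of `S` into two parts of given
distinct measures vanishes on all pairs consisting of one part and a subset of the other. -/
theorem biadditive_eq_zero_of_partition {ν : Set unitInterval → Set unitInterval → ℝ}
    (hadd : ∀ B, MeasurableSet B → IsDominatedAdditive (ν B)) (hsymm : ∀ B E, ν B E = ν E B)
    {S : Set unitInterval} (hS : MeasurableSet S) {a₁ a₂ : ℝ} (ha₁ : 0 < a₁) (ha₂ : 0 < a₂)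
    (hne : a₁ ≠ a₂) (hSm : volume.real S = a₁ + a₂)
    (hpart : ∀ A, MeasurableSet A → A ⊆ S → volume.real A = a₁ → ν A (S \ A) = 0)
    {A B : Set unitInterval} (hA : MeasurableSet A) (hAS : A ⊆ S) (hAm : volume.real A = a₁)
    (hB : MeasurableSet B) (hBA : B ⊆ A) : ν (S \ A) B = 0 := by
  have haddl : ∀ B B' E, MeasurableSet B → MeasurableSet B' → MeasurableSet E → Disjoint B B' →
      ν (B ∪ B') E = ν B E + ν B' E := by
    intro B B' E hB hB' hE hd
    rw [hsymm, (hadd E hE).add B B' hB hB' hd, hsymm E B, hsymm E B']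
  -- The threshold keeps `B` strictly smaller than both parts, so `C` and `S' \ C` below have
  -- positive measure.
  refine (hadd _ (hS.diff hA)).eq_zero_of_equidistributed hA (b₀ := min a₁ a₂ / 2)
    (by positivity) ?_ ((hsymm _ _).trans (hpart A hA hAS hAm)) hB hBA
  intro B B' hB hB' hBA hB'A hd heq hle
  have h1 : volume.real B < a₁ := by linarith [min_le_left a₁ a₂]
  have h2 : volume.real B < a₂ := by linarith [min_le_right a₁ a₂]
  have hBS := hBA.trans hAS
  have hB'S := hB'A.trans hAS
  set S' := S \ (B ∪ B') with hS'
  have hS'meas : MeasurableSet S' := hS.diff (hB.union hB')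
  have hS'm : volume.real S' = a₁ + a₂ - 2 * volume.real B := by
    rw [hS', measureReal_sdiff (Set.union_subset hBS hB'S) (hB.union hB'), measureReal_union hd hB',
      ← heq, hSm]
    ring
  have hδ := (hadd B hB).sub (hadd B' hB')
  -- With `δ = ν B - ν B'` and `D = S' \ C`, compare the partitions `(C ∪ B, D ∪ B')` and `(C ∪ B',
  -- D ∪ B)`. Their difference gives `δ C = δ D`, so each is half of `δ S'`.
  have hδC : ∀ C, MeasurableSet C → C ⊆ S' → volume.real C = a₁ - volume.real B →
      ν B C - ν B' C = (ν B S' - ν B' S') / 2 := by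
    intro C hC hCS hCm
    have hD : MeasurableSet (S' \ C) := hS'meas.diff hC
    have hdC : Disjoint C (B ∪ B') := Set.disjoint_sdiff_left.mono_left hCS
    have hdB := (Set.disjoint_union_right.1 hdC).1
    have hdB' := (Set.disjoint_union_right.1 hdC).2
    have hCS0 : C ⊆ S := hCS.trans Set.sdiff_subset
    have hdD : Disjoint (S' \ C) (B ∪ B') := Set.disjoint_sdiff_left.mono_left Set.sdiff_subset
    have hdDB := (Set.disjoint_union_right.1 hdD).1
    have hdDB' := (Set.disjoint_union_right.1 hdD).2
    have c1 : S \ (C ∪ B) = (S' \ C) ∪ B' := by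
      ext z
      have u1 := fun h : z ∈ B => Set.disjoint_left.1 hd h
      have u2 := fun h : z ∈ C => Set.disjoint_left.1 hdB' h
      have u3 := @hB'S z
      simp only [hS', Set.mem_sdiff, Set.mem_union]
      tauto
    have c2 : S \ (C ∪ B') = (S' \ C) ∪ B := by
      ext z
      have u1 := fun h : z ∈ B => Set.disjoint_left.1 hd h
      have u2 := fun h : z ∈ C => Set.disjoint_left.1 hdB h
      have u3 := @hBS z
      simp only [hS', Set.mem_sdiff, Set.mem_union]
      tauto
    have e1 := hpart (C ∪ B) (hC.union hB) (Set.union_subset hCS0 hBS)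
      (by rw [measureReal_union hdB hB, hCm]; ring)
    have e2 := hpart (C ∪ B') (hC.union hB') (Set.union_subset hCS0 hB'S)
      (by rw [measureReal_union hdB' hB', hCm, ← heq]; ring)
    rw [c1, haddl C B _ hC hB (hD.union hB') hdB, (hadd C hC).add _ _ hD hB' hdDB',
      (hadd B hB).add _ _ hD hB' hdDB'] at e1
    rw [c2, haddl C B' _ hC hB' (hD.union hB) hdB', (hadd C hC).add _ _ hD hB hdDB,
      (hadd B' hB').add _ _ hD hB hdDB] at e2
    have e3 := (hadd B hB).add_diff hC hS'meas hCS
    have e4 := (hadd B' hB').add_diff hC hS'meas hCS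
    rw [hsymm C B', hsymm B B'] at e1
    rw [hsymm C B] at e2
    linarith
  have hlin := fun E hE hES => hδ.eq_mul_of_forall_measure_eq hS'meas (by linarith)
    (by rw [hS'm]; linarith) hδC (B := E) hE hES
  -- Thus `δ` is proportional to the measure on `S'`, yet `C`, in general not half of `S'`, carries
  -- half of `δ S'`. This gives `δ S' * (a₁ - a₂) = 0`, where the inequality of the measures enters.
  have htop := hlin S' hS'meas subset_rfl
  have hzero : ν B S' - ν B' S' = 0 := by
    have hpos : a₁ - volume.real B ≠ 0 := by linarith
    rw [hS'm] at htop
    field_simp at htop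
    have : (ν B S' - ν B' S') * (a₁ - a₂) = 0 := by linarith
    exact (mul_eq_zero.1 this).resolve_right (sub_ne_zero.2 hne)
  have hfin := hlin (S \ A) (hS.diff hA)
    (Set.sdiff_subset_sdiff_right (Set.union_subset hBA hB'A))
  rw [hzero] at hfin
  rw [hsymm _ B, hsymm _ B']
  simpa [sub_eq_zero] using hfin

/-! ### Integrals over boxes -/

section Box

variable {m : ℕ}

theorem measurePreserving_eval_pair {i j : Fin m} (hij : i ≠ j) :
    MeasurePreserving (fun x : Fin m → unitInterval => (x i, x j)) volume volume where
  measurable := by fun_prop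
  map_eq := by
    have h := ProbabilityTheory.iIndepFun_pi (μ := fun _ : Fin m => (volume : Measure unitInterval))
      (X := fun _ => id) (fun _ => aemeasurable_id)
    have h2 := (ProbabilityTheory.indepFun_iff_map_prod_eq_prod_map_map
      (measurable_pi_apply i).aemeasurable (measurable_pi_apply j).aemeasurable).1 (h.indepFun hij)
    have h3 : ∀ k : Fin m, Measure.map (fun x : Fin m → unitInterval => x k)
        (Measure.pi fun _ => volume) = volume :=
      fun k => (measurePreserving_eval (fun _ : Fin m => (volume : Measure unitInterval)) k).map_eq
    rw [h3, h3] at h2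
    exact h2

theorem ae_injective : ∀ᵐ x : Fin m → unitInterval, Function.Injective x := by
  have hd : ∀ᵐ z : unitInterval × unitInterval, z.1 ≠ z.2 := by
    refine (Measure.measure_prod_null (measurableSet_eq_fun measurable_fst
      measurable_snd).compl.compl).2 (Filter.Eventually.of_forall fun x => ?_)
    simp [Set.preimage]
  have : ∀ i j : Fin m, i ≠ j → ∀ᵐ x : Fin m → unitInterval, x i ≠ x j := fun i j hij =>
    (measurePreserving_eval_pair hij).quasiMeasurePreserving.ae hd
  have h2 : ∀ᵐ x : Fin m → unitInterval, ∀ i j : Fin m, i ≠ j → x i ≠ x j := by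
    simpa only [ae_all_iff] using this
  filter_upwards [h2] with x hx i j hxij
  by_contra hne
  exact hx i j hne hxij

theorem integral_box_update (f : (Fin m → unitInterval) → ℝ) (A : Fin m → Set unitInterval)
    (i : Fin m) (B : Set unitInterval) :
    ∫ x in Set.univ.pi (Function.update A i B), f x =
      ∫ x in Set.univ.pi (Function.update A i Set.univ) ∩ Function.eval i ⁻¹' B, f x := by
  congr 2
  ext x
  simp only [Set.mem_pi, Set.mem_univ, true_implies, Set.mem_inter_iff, Set.mem_preimage,
    Function.eval]
  constructor
  · intro h
    refine ⟨fun k => ?_, by simpa using h i⟩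
    rcases eq_or_ne k i with rfl | hk
    · simp
    · simpa [hk] using h k
  · rintro ⟨h, hi⟩ k
    rcases eq_or_ne k i with rfl | hk
    · simpa using hi
    · simpa [hk] using h k

theorem integrable_of_bounded {f : (Fin m → unitInterval) → ℝ} (hf : Measurable f) {C : ℝ}
    (hC : ∀ x, |f x| ≤ C) : Integrable f :=
  Integrable.of_bound hf.aestronglyMeasurable C (Filter.Eventually.of_forall hC)

theorem isDominatedAdditive_box {f : (Fin m → unitInterval) → ℝ} (hf : Measurable f) {C : ℝ}
    (hC : ∀ x, |f x| ≤ C) {A : Fin m → Set unitInterval} (hA : ∀ i, MeasurableSet (A i))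
    (i : Fin m) :
    IsDominatedAdditive fun B => ∫ x in Set.univ.pi (Function.update A i B), f x where
  add B B' hB hB' hd := by
    have hA' : MeasurableSet (Set.univ.pi (Function.update A i Set.univ)) := by
      refine MeasurableSet.univ_pi fun k => ?_
      rcases eq_or_ne k i with rfl | hk
      · simp
      · simpa [hk] using hA k
    simp only [integral_box_update f A i]
    rw [Set.preimage_union, Set.inter_union_distrib_left]
    exact setIntegral_union ((hd.preimage _).mono Set.inter_subset_right Set.inter_subset_right)
      (hA'.inter (measurable_pi_apply i hB')) (integrable_of_bounded hf hC).integrableOn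
      (integrable_of_bounded hf hC).integrableOn
  bound := by
    refine ⟨|C|, abs_nonneg C, fun B hB => ?_⟩
    simp only [integral_box_update f A i]
    have hC' : ∀ x ∈ Set.univ.pi (Function.update A i Set.univ) ∩ Function.eval i ⁻¹' B,
        ‖f x‖ ≤ |C| := fun x _ => (hC x).trans (le_abs_self C)
    refine (norm_setIntegral_le_of_norm_le_const (measure_lt_top _ _) hC').trans ?_
    refine mul_le_mul_of_nonneg_left ?_ (abs_nonneg C)
    refine (measureReal_mono Set.inter_subset_right).trans_eq ?_
    exact (measurePreserving_eval (fun _ : Fin m => (volume : Measure unitInterval)) i).measureReal_preimage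
      hB.nullMeasurableSet

theorem piCongrLeft_symm_apply (σ : Equiv.Perm (Fin m)) (x : Fin m → unitInterval) :
    MeasurableEquiv.piCongrLeft (fun _ : Fin m => unitInterval) σ.symm x = fun i => x (σ i) := by
  ext i
  obtain ⟨k, rfl⟩ := σ.symm.surjective i
  simp [MeasurableEquiv.coe_piCongrLeft]

theorem measurePreserving_comp_perm (σ : Equiv.Perm (Fin m)) :
    MeasurePreserving (fun (x : Fin m → unitInterval) i => x (σ i)) volume volume := by
  convert volume_measurePreserving_piCongrLeft (fun _ : Fin m => unitInterval) σ.symm using 1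
  exact funext fun x => (piCongrLeft_symm_apply σ x).symm

theorem integral_box_comp_perm {f : (Fin m → unitInterval) → ℝ} (σ : Equiv.Perm (Fin m))
    (A : Fin m → Set unitInterval) :
    ∫ x in Set.univ.pi (fun i => A (σ i)), f x = ∫ x in Set.univ.pi A, f fun i => x (σ i) := by
  rw [← (volume_measurePreserving_piCongrLeft (fun _ : Fin m => unitInterval)
    σ.symm).setIntegral_preimage_emb (MeasurableEquiv.measurableEmbedding _)]
  simp only [piCongrLeft_symm_apply]
  congr 2
  ext x
  simp only [Set.mem_preimage, Set.mem_pi, Set.mem_univ, true_implies, piCongrLeft_symm_apply]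
  exact ⟨fun h i => by simpa using h (σ.symm i), fun h i => h (σ i)⟩

/-! ### Boxes with disjoint sides. -/

theorem isDisjointFamily_iff {α : Fin m → ℝ} (hα : ∀ i, 0 ≤ α i) {A : Fin m → Set unitInterval} :
    IsDisjointFamily α A ↔ (∀ i, MeasurableSet (A i)) ∧ (Pairwise fun i j => Disjoint (A i) (A j)) ∧
      ∀ i, volume.real (A i) = α i := by
  have key : ∀ i, volume (A i) = ENNReal.ofReal (α i) ↔ volume.real (A i) = α i := fun i => by
    rw [← ofReal_measureReal (μ := volume) (s := A i),
      ENNReal.ofReal_eq_ofReal_iff measureReal_nonneg (hα i)]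
  exact ⟨fun h => ⟨h.1, h.2, fun i => (key i).1 (h.3 i)⟩,
    fun h => ⟨h.1, h.2.1, fun i => (key i).2 (h.2.2 i)⟩⟩

theorem measureReal_biUnion_compl {A : Fin m → Set unitInterval} (hA : ∀ i, MeasurableSet (A i))
    (hd : Pairwise fun i j => Disjoint (A i) (A j)) (T : Finset (Fin m)) :
    volume.real (⋃ k ∈ T, A k)ᶜ = 1 - ∑ k ∈ T, volume.real (A k) := by
  rw [probReal_compl_eq_one_sub (T.measurableSet_biUnion fun k _ => hA k),
    measureReal_biUnion_finset (fun i _ j _ hij => hd hij) (fun k _ => hA k)]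

theorem pairwise_disjoint_update {A : Fin m → Set unitInterval}
    (hd : Pairwise fun i j => Disjoint (A i) (A j)) {i : Fin m} {B : Set unitInterval}
    (hB : ∀ k, k ≠ i → Disjoint B (A k)) :
    Pairwise fun k l => Disjoint (Function.update A i B k) (Function.update A i B l) := by
  intro k l hkl
  rcases eq_or_ne k i with rfl | hk
  · simpa [hkl.symm] using hB l hkl.symm
  · rcases eq_or_ne l i with rfl | hl
    · simpa [hk] using (hB k hk).symm
    · simpa [hk, hl] using hd hkl

theorem measurableSet_update {A : Fin m → Set unitInterval} (hA : ∀ i, MeasurableSet (A i))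
    {i : Fin m} {B : Set unitInterval} (hB : MeasurableSet B) (k : Fin m) :
    MeasurableSet (Function.update A i B k) := by
  rcases eq_or_ne k i with rfl | hk
  · simpa using hB
  · simpa [hk] using hA k

/-- If the integrals over all disjoint boxes with sides of measures `α i` vanish and `∑ α i < 1`,
then so do those over disjoint boxes with smaller sides. -/
theorem integral_box_eq_zero_of_le {f : (Fin m → unitInterval) → ℝ} (hf : Measurable f) {C : ℝ}
    (hC : ∀ x, |f x| ≤ C) {α : Fin m → ℝ} (hα : ∀ i, 0 < α i) (hsum : ∑ i, α i < 1)
    (h : ∀ A, IsDisjointFamily α A → ∫ x in Set.univ.pi A, f x = 0)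
    (T : Finset (Fin m)) (A : Fin m → Set unitInterval) (hA : ∀ i, MeasurableSet (A i))
    (hd : Pairwise fun i j => Disjoint (A i) (A j))
    (hle : ∀ i ∈ T, volume.real (A i) ≤ α i) (heq : ∀ i ∉ T, volume.real (A i) = α i) :
    ∫ x in Set.univ.pi A, f x = 0 := by
  induction T using Finset.induction_on generalizing A with
  | empty =>
    exact h A ((isDisjointFamily_iff fun i => (hα i).le).2 ⟨hA, hd, fun i => heq i (by simp)⟩)
  | insert i T hi ih =>
    have hle' : ∀ k, volume.real (A k) ≤ α k := fun k => by
      by_cases hk : k ∈ insert i T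
      · exact hle k hk
      · exact (heq k hk).le
    set S : Set unitInterval := (⋃ k ∈ Finset.univ.erase i, A k)ᶜ with hS
    have hSmeas : MeasurableSet S :=
      (Finset.measurableSet_biUnion _ fun k _ => hA k).compl
    have hmem : ∀ {B : Set unitInterval}, B ⊆ S ↔ ∀ k, k ≠ i → Disjoint B (A k) := by
      intro B
      rw [hS, Set.subset_compl_iff_disjoint_right]
      simp [Set.disjoint_iUnion_right]
    -- The strict inequality is the slack `1 - ∑ α k > 0`; the other sides may only have shrunk.
    have hSm : α i < volume.real S := by
      rw [hS, measureReal_biUnion_compl hA hd]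
      have h1 : ∑ k ∈ Finset.univ.erase i, volume.real (A k) ≤ ∑ k ∈ Finset.univ.erase i, α k :=
        Finset.sum_le_sum fun k _ => hle' k
      have h2 := Finset.add_sum_erase Finset.univ α (Finset.mem_univ i)
      linarith
    have key := (isDominatedAdditive_box hf hC hA i).eq_zero_of_forall_measure_eq hSmeas (hα i) hSm
      (fun B hB hBS hBm => ?_) (hA i) (hmem.2 fun k hk => hd hk.symm)
    · simpa using key
    · refine ih _ (measurableSet_update hA hB) (pairwise_disjoint_update hd (hmem.1 hBS)) ?_ ?_
      · intro k hk
        have hki : k ≠ i := fun h => hi (h ▸ hk)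
        simpa [hki] using hle' k
      · intro k hk
        rcases eq_or_ne k i with rfl | hki
        · simpa using hBm
        · simpa [hki] using heq k (by simp [hki, hk])

/-- Boxes form a π-system generating the product σ-algebra, so the integral of `f` vanishes over
every measurable subset of the box. -/
theorem ae_eq_zero_on_box {f : (Fin m → unitInterval) → ℝ} (hf : Measurable f) {C : ℝ}
    (hC : ∀ x, |f x| ≤ C) {J : Fin m → Set unitInterval} (hJ : ∀ i, MeasurableSet (J i))
    (h : ∀ A, (∀ i, MeasurableSet (A i)) → (∀ i, A i ⊆ J i) → ∫ x in Set.univ.pi A, f x = 0) :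
    ∀ᵐ x : Fin m → unitInterval, x ∈ Set.univ.pi J → f x = 0 := by
  have hP : MeasurableSet (Set.univ.pi J) := MeasurableSet.univ_pi hJ
  have hint : Integrable f (volume.restrict (Set.univ.pi J)) :=
    (integrable_of_bounded hf hC).restrict
  have key : ∀ E, MeasurableSet E → ∫ x in E, f x ∂(volume.restrict (Set.univ.pi J)) = 0 := by
    have huniv : ∫ x, f x ∂(volume.restrict (Set.univ.pi J)) = 0 := h J hJ fun _ => subset_rfl
    intro E hE
    refine MeasurableSpace.induction_on_inter
      (C := fun E _ => ∫ x in E, f x ∂(volume.restrict (Set.univ.pi J)) = 0)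
      generateFrom_pi.symm isPiSystem_pi (by simp) ?_ ?_ ?_ E hE
    · rintro _ ⟨t, ht, rfl⟩
      have ht' : ∀ i, MeasurableSet (t i) := fun i => ht i (Set.mem_univ i)
      rw [Measure.restrict_restrict (MeasurableSet.univ_pi ht'), ← Set.pi_inter_distrib]
      exact h _ (fun i => (ht' i).inter (hJ i)) fun i => Set.inter_subset_right
    · intro E hE ih
      have := integral_add_compl hE hint
      rwa [ih, huniv, zero_add] at this
    · intro E hd hE ih
      rw [integral_iUnion hE hd hint.integrableOn]
      simp [ih]
  have := hint.ae_eq_zero_of_forall_setIntegral_eq_zero fun s hs _ => key s hs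
  exact (ae_restrict_iff' hP).1 this

/-- Almost every point has distinct coordinates, hence lies in a box whose sides are disjoint short
rational intervals. There are only countably many such boxes. -/
theorem ae_eq_zero_of_integral_box_eq_zero {f : (Fin m → unitInterval) → ℝ} (hf : Measurable f)
    {C : ℝ} (hC : ∀ x, |f x| ≤ C) {α : Fin m → ℝ} (hα : ∀ i, 0 < α i)
    (h : ∀ A : Fin m → Set unitInterval, (∀ i, MeasurableSet (A i)) →
      (Pairwise fun i j => Disjoint (A i) (A j)) →
      (∀ i, volume.real (A i) ≤ α i) → ∫ x in Set.univ.pi A, f x = 0) :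
    ∀ᵐ x : Fin m → unitInterval, f x = 0 := by
  let J : ℚ × ℚ → Set unitInterval := fun q => Subtype.val ⁻¹' Set.Ioo (q.1 : ℝ) q.2
  have hJm : ∀ q, MeasurableSet (J q) := fun q => measurable_subtype_coe measurableSet_Ioo
  have hJv : ∀ q, volume.real (J q) ≤ max ((q.2 : ℝ) - q.1) 0 := by
    intro q
    have : volume (J q) ≤ ENNReal.ofReal (q.2 - q.1) := by
      rw [unitInterval.volume_apply, ← Real.volume_Ioo]
      exact measure_mono (Set.image_preimage_subset _ _)
    exact (ENNReal.toReal_mono ENNReal.ofReal_ne_top this).trans_eq ENNReal.toReal_ofReal'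
  have hbox : ∀ q : Fin m → ℚ × ℚ, ∀ᵐ x : Fin m → unitInterval,
      (Pairwise fun i j => Disjoint (J (q i)) (J (q j))) → (∀ i, volume.real (J (q i)) ≤ α i) →
      x ∈ Set.univ.pi (fun i => J (q i)) → f x = 0 := by
    intro q
    by_cases hq : (Pairwise fun i j => Disjoint (J (q i)) (J (q j))) ∧
        ∀ i, volume.real (J (q i)) ≤ α i
    · filter_upwards [ae_eq_zero_on_box hf hC (fun i => hJm (q i)) fun A hA hAJ =>
        h A hA (fun i j hij => (hq.1 hij).mono (hAJ i) (hAJ j))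
          fun i => (measureReal_mono (hAJ i)).trans (hq.2 i)] with x hx _ _ using hx
    · exact Filter.Eventually.of_forall fun x h1 h2 => absurd ⟨h1, h2⟩ hq
  filter_upwards [ae_all_iff.2 hbox, ae_injective] with x hx hinj
  -- The interval around `x i` will lie within `δ` of it: its length is below `2 * δ`, and two such
  -- intervals are disjoint once the centres are more than `2 * δ` apart.
  have hδ : ∀ᶠ δ : ℝ in nhdsWithin 0 (Set.Ioi 0), (∀ i, 2 * δ < α i) ∧
      ∀ i j, i ≠ j → 2 * δ < |(x i : ℝ) - x j| := by
    have hlim : Filter.Tendsto (fun δ : ℝ => 2 * δ) (nhdsWithin 0 (Set.Ioi 0)) (nhds 0) := by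
      have : Filter.Tendsto (fun δ : ℝ => 2 * δ) (nhds 0) (nhds (2 * 0)) := by
        exact (continuous_const.mul continuous_id).tendsto 0
      rw [mul_zero] at this
      exact this.mono_left nhdsWithin_le_nhds
    refine (Filter.eventually_all.2 fun i => hlim.eventually_lt_const (hα i)).and ?_
    refine Filter.eventually_all.2 fun i => Filter.eventually_all.2 fun j => ?_
    by_cases hij : i = j
    · simp [hij]
    · have hpos : 0 < |(x i : ℝ) - x j| :=
        abs_pos.2 (sub_ne_zero.2 fun hxx => hij (hinj (Subtype.ext hxx)))
      exact (hlim.eventually_lt_const hpos).mono fun _ h _ => h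
  obtain ⟨δ, ⟨hδα, hδx⟩, hδ0⟩ := (hδ.and self_mem_nhdsWithin).exists
  replace hδ0 : 0 < δ := hδ0
  have hlo : ∀ i, ∃ a : ℚ, (x i : ℝ) - δ < a ∧ (a : ℝ) < x i := fun i =>
    exists_rat_btwn (by linarith)
  have hhi : ∀ i, ∃ a : ℚ, (x i : ℝ) < a ∧ (a : ℝ) < x i + δ := fun i =>
    exists_rat_btwn (by linarith)
  choose a ha using hlo
  choose b hb using hhi
  refine hx (fun i => (a i, b i)) ?_ ?_ fun i _ => ⟨(ha i).2, (hb i).1⟩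
  · intro i j hij
    refine Set.disjoint_left.2 fun z hz hz' => ?_
    have h1 : (a i : ℝ) < z ∧ (z : ℝ) < b i := hz
    have h2 : (a j : ℝ) < z ∧ (z : ℝ) < b j := hz'
    have h3 := hδx i j hij
    have h4 := ha i
    have h5 := hb i
    have h6 := ha j
    have h7 := hb j
    rcases lt_abs.1 h3 with h8 | h8 <;> linarith
  · intro i
    refine (hJv _).trans (max_le ?_ (hα i).le)
    have := hδα i
    have h4 := ha i
    have h5 := hb i
    simp only
    linarith

theorem ae_eq_zero_of_sum_lt_one {f : (Fin m → unitInterval) → ℝ} (hf : Measurable f) {C : ℝ}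
    (hC : ∀ x, |f x| ≤ C) {α : Fin m → ℝ} (hα : ∀ i, 0 < α i) (hsum : ∑ i, α i < 1)
    (h : ∀ A, IsDisjointFamily α A → ∫ x in Set.univ.pi A, f x = 0) :
    ∀ᵐ x : Fin m → unitInterval, f x = 0 :=
  ae_eq_zero_of_integral_box_eq_zero hf hC hα fun A hA hd hle =>
    integral_box_eq_zero_of_le hf hC hα hsum h Finset.univ A hA hd (fun i _ => hle i)
      fun i hi => absurd (Finset.mem_univ i) hi

/-- For symmetric `f` and `∑ α i = 1`, one side of the disjoint boxes on which the integral
vanishes can be halved. -/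
theorem integral_box_eq_zero_of_half {f : (Fin m → unitInterval) → ℝ} (hf : Measurable f) {C : ℝ}
    (hC : ∀ x, |f x| ≤ C) (hfs : ∀ (σ : Equiv.Perm (Fin m)) x, f (fun i => x (σ i)) = f x)
    {α : Fin m → ℝ} (hα : ∀ i, 0 < α i) (hsum : ∑ i, α i = 1)
    (h : ∀ A, IsDisjointFamily α A → ∫ x in Set.univ.pi A, f x = 0)
    {i j : Fin m} (hne : α i ≠ α j) (A : Fin m → Set unitInterval)
    (hA' : IsDisjointFamily (Function.update α i (α i / 2)) A) :
    ∫ x in Set.univ.pi A, f x = 0 := by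
  have hij : i ≠ j := fun h => hne (h ▸ rfl)
  obtain ⟨hA, hd, hm⟩ := (isDisjointFamily_iff fun k => by
    rcases eq_or_ne k i with rfl | hk
    · simpa using (half_pos (hα k)).le
    · simpa [hk] using (hα k).le).1 hA'
  have hmi : ∀ k, k ≠ i → volume.real (A k) = α k := fun k hk => by simpa [hk] using hm k
  let ν : Set unitInterval → Set unitInterval → ℝ := fun B E =>
    ∫ x in Set.univ.pi (Function.update (Function.update A i B) j E), f x
  have hadd : ∀ B, MeasurableSet B → IsDominatedAdditive (ν B) := fun B hB =>
    isDominatedAdditive_box hf hC (measurableSet_update hA hB) j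
  have hsymm : ∀ B E, ν B E = ν E B := by
    intro B E
    have h1 := integral_box_comp_perm (f := f) (Equiv.swap i j)
      (Function.update (Function.update A i B) j E)
    simp only [hfs] at h1
    refine h1.symm.trans ?_
    congr 3
    ext1 k
    rcases eq_or_ne k i with rfl | hki
    · simp [hij]
    · rcases eq_or_ne k j with rfl | hkj
      · simp [hij]
      · simp [Equiv.swap_apply_of_ne_of_ne hki hkj, hki, hkj]
  set S : Set unitInterval := (⋃ k ∈ (Finset.univ.erase i).erase j, A k)ᶜ with hS
  have hSmeas : MeasurableSet S := (Finset.measurableSet_biUnion _ fun k _ => hA k).compl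
  have hmem : ∀ {B : Set unitInterval}, B ⊆ S ↔ ∀ k, k ≠ j → k ≠ i → Disjoint B (A k) := by
    intro B
    rw [hS, Set.subset_compl_iff_disjoint_right]
    simp [Set.disjoint_iUnion_right]
  have hSm : volume.real S = α i + α j := by
    rw [hS, measureReal_biUnion_compl hA hd, Finset.sum_congr rfl fun k hk =>
      hmi k (Finset.mem_erase.1 (Finset.mem_erase.1 hk).2).1]
    have h2 := Finset.add_sum_erase Finset.univ α (Finset.mem_univ i)
    have h3 := Finset.add_sum_erase (Finset.univ.erase i) α
      (Finset.mem_erase.2 ⟨hij.symm, Finset.mem_univ j⟩)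
    linarith
  have hpart : ∀ B, MeasurableSet B → B ⊆ S → volume.real B = α i → ν B (S \ B) = 0 := by
    intro B hB hBS hBm
    refine h _ ((isDisjointFamily_iff fun k => (hα k).le).2
      ⟨measurableSet_update (measurableSet_update hA hB) (hSmeas.diff hB), ?_, ?_⟩)
    · intro k l hkl
      have hBk := hmem.1 hBS
      have hDk := hmem.1 (Set.sdiff_subset : S \ B ⊆ S)
      have hBD : Disjoint B (S \ B) := Set.disjoint_sdiff_right
      rcases eq_or_ne k i with rfl | hki
      · rcases eq_or_ne l j with rfl | hlj
        · simpa [hij] using hBD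
        · simpa [hij, hlj, hkl.symm] using hBk l hlj hkl.symm
      · rcases eq_or_ne k j with rfl | hkj
        · rcases eq_or_ne l i with rfl | hli
          · simpa [hij] using hBD.symm
          · simpa [hli, hkl.symm] using hDk l hkl.symm hli
        · rcases eq_or_ne l i with rfl | hli
          · simpa [hij, hki, hkj] using (hBk k hkj hki).symm
          · rcases eq_or_ne l j with rfl | hlj
            · simpa [hij, hki, hkj] using (hDk k hkj hki).symm
            · simpa [hki, hkj, hli, hlj] using hd hkl
    · intro k
      rcases eq_or_ne k j with rfl | hkj
      · simp only [Function.update_self]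
        rw [measureReal_sdiff hBS hB, hSm, hBm]
        ring
      · rcases eq_or_ne k i with rfl | hki
        · simpa [hij] using hBm
        · simpa [hki, hkj] using hmi k hki
  have hAi : A i ⊆ S := hmem.2 fun k _ hki => hd hki.symm
  have hAj : A j ⊆ S := hmem.2 fun k hkj _ => hd hkj.symm
  -- The part of measure `α i` is `S \ A j`, which contains the halved side `A i`; its complement in
  -- `S` is `A j`.
  have key := biadditive_eq_zero_of_partition hadd hsymm hSmeas (hα i) (hα j) hne hSm hpart
    (hSmeas.diff (hA j)) Set.sdiff_subset
    (by rw [measureReal_sdiff hAj (hA j), hSm, hmi j hij.symm]; ring) (hA i)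
    (Set.subset_sdiff.2 ⟨hAi, hd hij⟩)
  rw [Set.sdiff_sdiff_cancel_left hAj, hsymm] at key
  simpa [ν] using key

end Box

/-! ### Graphons with almost everywhere constant symmetrized edge products -/

section Rigidity

variable {m : ℕ}

theorem exists_perm_apply_eq {i j a b : Fin m} (hij : i ≠ j) (hab : a ≠ b) :
    ∃ σ : Equiv.Perm (Fin m), σ i = a ∧ σ j = b := by
  refine ⟨Equiv.swap (Equiv.swap i a j) b * Equiv.swap i a, ?_, ?_⟩
  · have h1 : a ≠ Equiv.swap i a j := by
      intro h
      have := congrArg (Equiv.swap i a) h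
      rw [Equiv.swap_apply_right, Equiv.swap_apply_self] at this
      exact hij this
    simp [Equiv.swap_apply_of_ne_of_ne h1 hab]
  · simp

/-- A sum of products of `n` factors each equal to `p` or `c` equals its value at `c = p` only if
`c = p`. -/
theorem eq_of_sum_prod_ite_eq {ι κ : Type*} [Fintype ι] (E : Finset κ) {c p : ℝ} (hc : 0 ≤ c)
    (hp : 0 < p) (P : ι → κ → Prop) [∀ s e, Decidable (P s e)] {s₀ : ι} {e₀ : κ} (he₀ : e₀ ∈ E)
    (hP : P s₀ e₀)
    (h : ∑ s, ∏ e ∈ E, (if P s e then c else p) = Fintype.card ι * p ^ E.card) : c = p := by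
  set r := c / p with hr
  have hr0 : 0 ≤ r := by positivity
  have hcr : c = p * r := by rw [hr]; field_simp
  have hprod : ∀ s, ∏ e ∈ E, (if P s e then c else p) =
      p ^ E.card * r ^ (E.filter (P s)).card := by
    intro s
    rw [← Finset.prod_const, ← Finset.prod_const, Finset.prod_filter, ← Finset.prod_mul_distrib]
    exact Finset.prod_congr rfl fun e _ => by split_ifs <;> simp [hcr]
  simp only [hprod, ← Finset.mul_sum] at h
  have hsum : ∑ s, r ^ (E.filter (P s)).card = ∑ _s : ι, (1 : ℝ) := by
    rw [mul_comm] at h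
    simpa using mul_right_cancel₀ (pow_pos hp _).ne' h
  have hpos : (E.filter (P s₀)).card ≠ 0 :=
    Finset.card_ne_zero_of_mem (Finset.mem_filter.2 ⟨he₀, hP⟩)
  -- The powers of `r` sum to their number. If `r ≠ 1`, all lie weakly on one side of 1, and the one
  -- at `s₀` strictly so.
  rcases lt_trichotomy r 1 with hlt | heq | hgt
  · refine absurd hsum (ne_of_lt ?_)
    exact Finset.sum_lt_sum (fun s _ => pow_le_one₀ hr0 hlt.le)
      ⟨s₀, Finset.mem_univ _, pow_lt_one₀ hr0 hlt hpos⟩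
  · rw [hcr, heq, mul_one]
  · refine absurd hsum (ne_of_gt ?_)
    exact Finset.sum_lt_sum (fun s _ => one_le_pow₀ hgt.le)
      ⟨s₀, Finset.mem_univ _, one_lt_pow₀ hgt hpos⟩

/-! ### Resampling coordinates and sending vertices to infinity. -/

theorem measurable_update_prod (i : Fin m) : Measurable
    (fun z : (Fin m → unitInterval) × unitInterval => Function.update z.1 i z.2) := by
  refine measurable_pi_lambda _ fun k => ?_
  rcases eq_or_ne k i with rfl | hk
  · simpa using measurable_snd
  · simp only [Function.update_of_ne hk]
    exact (measurable_pi_apply k).comp measurable_fst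

theorem measurePreserving_update (i : Fin m) :
    MeasurePreserving
      (fun z : (Fin m → unitInterval) × unitInterval => Function.update z.1 i z.2)
      (volume.prod volume) volume where
  measurable := measurable_update_prod i
  map_eq := by
    refine (Measure.pi_eq fun s hs => ?_).symm
    rw [Measure.map_apply (measurable_update_prod i) (MeasurableSet.univ_pi hs)]
    have : (fun z : (Fin m → unitInterval) × unitInterval => Function.update z.1 i z.2) ⁻¹'
        Set.univ.pi s = Set.univ.pi (Function.update s i Set.univ) ×ˢ s i := by
      ext z
      simp only [Set.mem_preimage, Set.mem_pi, Set.mem_univ, true_implies, Set.mem_prod]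
      constructor
      · intro h
        refine ⟨fun k => ?_, by simpa using h i⟩
        rcases eq_or_ne k i with rfl | hk
        · simp
        · simpa [hk] using h k
      · rintro ⟨h, hi⟩ k
        rcases eq_or_ne k i with rfl | hk
        · simpa using hi
        · simpa [hk] using h k
    rw [this, Measure.prod_prod, volume_pi, Measure.pi_pi,
      ← Finset.mul_prod_erase _ _ (Finset.mem_univ i),
      ← Finset.mul_prod_erase _ (fun i => volume (s i)) (Finset.mem_univ i), mul_comm]
    simp only [Function.update_self, measure_univ, one_mul]
    congr 1
    exact Finset.prod_congr rfl fun k hk => by simp [(Finset.mem_erase.1 hk).1]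

theorem ae_ae_update (i : Fin m) {P : (Fin m → unitInterval) → Prop} (h : ∀ᵐ x, P x) :
    ∀ᵐ x, ∀ᵐ y, P (Function.update x i y) :=
  Measure.ae_ae_of_ae_prod ((measurePreserving_update i).quasiMeasurePreserving.ae h)

/-- The weights on `[0,1] ∪ {∞}` extending `W` by `w` on pairs `(x, ∞)` and by `c` at `(∞, ∞)`. -/
def extendedWeight (W : unitInterval → unitInterval → ℝ) (w : unitInterval → ℝ) (c : ℝ) :
    Option unitInterval → Option unitInterval → ℝ
  | some x, some y => W x y
  | some x, none => w x
  | none, some y => w y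
  | none, none => c

theorem extendedWeight_comm (W : Graphon) (w : unitInterval → ℝ) (c : ℝ) :
    ∀ a b, extendedWeight W.toFun w c a b = extendedWeight W.toFun w c b a
  | some x, some y => W.symm' x y
  | some _, none => rfl
  | none, some _ => rfl
  | none, none => rfl

/-- The weight of an unordered pair of vertices placed in `[0,1] ∪ {∞}`. -/
def extendedEdgeWeight (W : Graphon) (w : unitInterval → ℝ) (c : ℝ)
    (z : Fin m → Option unitInterval) : Sym2 (Fin m) → ℝ :=
  Sym2.lift ⟨fun i j => extendedWeight W.toFun w c (z i) (z j),
    fun i j => extendedWeight_comm W w c (z i) (z j)⟩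

/-- Send all coordinates with index at least `k` to `∞`. -/
def truncate (k : ℕ) (x : Fin m → unitInterval) (i : Fin m) : Option unitInterval :=
  if i.val < k then some (x i) else none

/-- The symmetrized edge product, for vertices placed in `[0,1] ∪ {∞}`. -/
def extendedSymProd (W : Graphon) (w : unitInterval → ℝ) (c : ℝ) (F : SimpleGraph (Fin m))
    [DecidableRel F.Adj] (z : Fin m → Option unitInterval) : ℝ :=
  ∑ σ : Equiv.Perm (Fin m), ∏ e ∈ F.edgeFinset, extendedEdgeWeight W w c (fun i => z (σ i)) e

theorem extendedSymProd_truncate_self (W : Graphon) (w : unitInterval → ℝ) (c : ℝ)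
    (F : SimpleGraph (Fin m)) [DecidableRel F.Adj] (x : Fin m → unitInterval) :
    extendedSymProd W w c F (truncate m x) =
      ∑ σ : Equiv.Perm (Fin m), W.edgeProd F fun i => x (σ i) := by
  refine Finset.sum_congr rfl fun σ _ => Finset.prod_congr rfl fun e _ => ?_
  induction e with
  | _ i j => simp [extendedEdgeWeight, truncate, extendedWeight, Graphon.edgeWeight]

/-- Moves vertex `k` to `∞`. Edges join distinct vertices, so only one end moves at a time and the
uncontrolled diagonal values `W y y` never occur. -/
theorem tendsto_extendedSymProd {W : Graphon} {w : unitInterval → ℝ} {c : ℝ}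
    {U : Filter unitInterval}
    (hw : ∀ x, Filter.Tendsto (fun y => W.toFun x y) U (nhds (w x)))
    (hc : Filter.Tendsto w U (nhds c)) (F : SimpleGraph (Fin m)) [DecidableRel F.Adj]
    (k : Fin m) (x : Fin m → unitInterval) :
    Filter.Tendsto
      (fun y => extendedSymProd W w c F (truncate (k.val + 1) (Function.update x k y))) U
      (nhds (extendedSymProd W w c F (truncate k.val x))) := by
  refine tendsto_finsetSum _ fun σ _ => tendsto_finsetProd _ fun e he => ?_
  rw [SimpleGraph.mem_edgeFinset] at he
  induction e with
  | _ i j =>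
    have hij : σ i ≠ σ j := σ.injective.ne (F.ne_of_adj he)
    have hlt : ∀ a y, a < k → truncate (k.val + 1) (Function.update x k y) a = some (x a) := by
      intro a y ha
      have : a.val < k.val + 1 := by omega
      simp [truncate, this, ha.ne]
    have hlt' : ∀ a, a < k → truncate k.val x a = some (x a) := by
      intro a ha
      have : a.val < k.val := ha
      simp [truncate, this]
    have hgt : ∀ a y, k < a → truncate (k.val + 1) (Function.update x k y) a = none := by
      intro a y ha
      have : ¬ a.val < k.val + 1 := by omega
      simp [truncate, this]
    have hgt' : ∀ a, k ≤ a → truncate k.val x a = none := by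
      intro a ha
      have : ¬ a.val < k.val := by omega
      simp [truncate, this]
    have hk : ∀ y, truncate (k.val + 1) (Function.update x k y) k = some y := by
      intro y
      simp [truncate]
    simp only [extendedEdgeWeight, Sym2.lift_mk]
    rcases lt_trichotomy (σ i) k with hi | hi | hi <;>
      rcases lt_trichotomy (σ j) k with hj | hj | hj
    · simp only [hlt _ _ hi, hlt _ _ hj, hlt' _ hi, hlt' _ hj]
      exact tendsto_const_nhds
    · simp only [hlt _ _ hi, hlt' _ hi, hj, hk, hgt' k le_rfl, extendedWeight]
      exact hw _
    · simp only [hlt _ _ hi, hlt' _ hi, hgt _ _ hj, hgt' _ hj.le]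
      exact tendsto_const_nhds
    · simp only [hlt _ _ hj, hlt' _ hj, hi, hk, hgt' k le_rfl, extendedWeight, W.symm' _ (x (σ j))]
      exact hw _
    · exact absurd (hi.trans hj.symm) hij
    · simp only [hgt _ _ hj, hgt' _ hj.le, hi, hk, hgt' k le_rfl, extendedWeight]
      exact hc
    · simp only [hgt _ _ hi, hgt' _ hi.le, hlt _ _ hj, hlt' _ hj]
      exact tendsto_const_nhds
    · simp only [hgt _ _ hi, hgt' _ hi.le, hj, hk, hgt' k le_rfl, extendedWeight]
      exact hc
    · simp only [hgt _ _ hi, hgt' _ hi.le, hgt _ _ hj, hgt' _ hj.le]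
      exact tendsto_const_nhds

/-- Downward induction on `k`: for almost every `x` the identity holds for almost every value `y` of
coordinate `k`, hence `U`-eventually, and passes to the limit. -/
theorem ae_extendedSymProd_truncate {W : Graphon} {w : unitInterval → ℝ} {c v : ℝ}
    {U : Filter unitInterval} [U.NeBot] (hU : U ≤ ae volume)
    (hw : ∀ x, Filter.Tendsto (fun y => W.toFun x y) U (nhds (w x)))
    (hc : Filter.Tendsto w U (nhds c)) (F : SimpleGraph (Fin m)) [DecidableRel F.Adj]
    (h : ∀ᵐ x : Fin m → unitInterval, ∑ σ : Equiv.Perm (Fin m), W.edgeProd F (fun i => x (σ i)) = v)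
    {k : ℕ} (hk : k ≤ m) :
    ∀ᵐ x : Fin m → unitInterval, extendedSymProd W w c F (truncate k x) = v := by
  induction hk using Nat.decreasingInduction with
  | self => simpa only [extendedSymProd_truncate_self] using h
  | of_succ k hk ih =>
    filter_upwards [ae_ae_update ⟨k, hk⟩ ih] with x hx
    exact tendsto_nhds_unique (tendsto_extendedSymProd hw hc F ⟨k, hk⟩ x)
      (tendsto_const_nhds.congr' (Filter.Eventually.mono (hU hx) fun y hy => hy.symm))

theorem exists_ultrafilter_limit (U : Ultrafilter unitInterval) {g : unitInterval → ℝ}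
    (hg : ∀ x, g x ∈ Set.Icc (0 : ℝ) 1) :
    ∃ c ∈ Set.Icc (0 : ℝ) 1, Filter.Tendsto g U (nhds c) := by
  obtain ⟨c, hc, hlim⟩ := isCompact_Icc.ultrafilter_le_nhds (U.map g)
    (Filter.le_principal_iff.2 (Filter.Eventually.of_forall hg : ∀ᶠ x in (U : Filter unitInterval), _))
  exact ⟨c, hc, hlim⟩

theorem eqConst_of_ae_sum_edgeProd_eq {W : Graphon} {p : ℝ} (hp : 0 < p)
    (F : SimpleGraph (Fin m)) [DecidableRel F.Adj] (hF : F.edgeSet.Nonempty)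
    (h : ∀ᵐ x : Fin m → unitInterval, ∑ σ : Equiv.Perm (Fin m), W.edgeProd F (fun i => x (σ i)) =
      m.factorial * p ^ F.edgeFinset.card) : W.EqConst p := by
  obtain ⟨e₀, he₀⟩ := hF
  induction e₀ with
  | _ i₀ j₀ =>
  have hne : i₀ ≠ j₀ := F.ne_of_adj he₀
  have he₀' : s(i₀, j₀) ∈ F.edgeFinset := SimpleGraph.mem_edgeFinset.2 he₀
  have hm : 2 ≤ m := by
    have h1 := i₀.isLt
    have h2 := j₀.isLt
    have h3 : i₀.val ≠ j₀.val := fun h => hne (Fin.ext h)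
    omega
  let v₀ : Fin m := ⟨0, by omega⟩
  let v₁ : Fin m := ⟨1, by omega⟩
  have hv : v₀ ≠ v₁ := fun h => by simpa [v₀, v₁] using congrArg Fin.val h
  obtain ⟨σ₀, hσi, hσj⟩ := exists_perm_apply_eq hne hv
  -- An ultrafilter gives limits of all bounded functions by compactness; the limit function `w`
  -- need not be measurable.
  set U := Ultrafilter.of (ae (volume : Measure unitInterval)) with hUdef
  have hU : (U : Filter unitInterval) ≤ ae volume := Ultrafilter.of_le _
  choose w hwmem hw using fun x => exists_ultrafilter_limit U
    (fun y => ⟨W.nonneg' x y, W.le_one' x y⟩ : ∀ y, W.toFun x y ∈ Set.Icc (0 : ℝ) 1)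
  obtain ⟨c, hcmem, hc⟩ := exists_ultrafilter_limit U hwmem
  have hrel := fun k (hk : k ≤ m) => ae_extendedSymProd_truncate hU hw hc F h hk
  have hcard : (Fintype.card (Equiv.Perm (Fin m)) : ℝ) = m.factorial := by
    rw [Fintype.card_perm, Fintype.card_fin]
  -- `P` marks the pairs that carry the unknown weight `a`; all other pairs carry `p`.
  have key : ∀ (z : Fin m → Option unitInterval) (a : ℝ) (P : Equiv.Perm (Fin m) → Sym2 (Fin m) → Prop),
      extendedSymProd W w c F z = m.factorial * p ^ F.edgeFinset.card → 0 ≤ a →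
      P σ₀ s(i₀, j₀) →
      (∀ σ i j, i ≠ j → (P σ s(i, j) → extendedWeight W.toFun w c (z (σ i)) (z (σ j)) = a) ∧
        (¬ P σ s(i, j) → extendedWeight W.toFun w c (z (σ i)) (z (σ j)) = p)) → a = p := by
    classical
    intro z a P hz ha hP hval
    refine eq_of_sum_prod_ite_eq F.edgeFinset ha hp P he₀' hP ?_
    rw [hcard, ← hz]
    refine Finset.sum_congr rfl fun σ _ => Finset.prod_congr rfl fun e he => ?_
    rw [SimpleGraph.mem_edgeFinset] at he
    induction e with
    | _ i j =>
      have := hval σ i j (F.ne_of_adj he)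
      simp only [extendedEdgeWeight, Sym2.lift_mk]
      split_ifs with hPe
      · exact (this.1 hPe).symm
      · exact (this.2 hPe).symm
  have hcp : c = p := by
    obtain ⟨x, hx⟩ := (hrel 0 (Nat.zero_le m)).exists
    exact key _ c (fun _ _ => True) hx hcmem.1 trivial fun σ i j _ =>
      ⟨fun _ => by simp [truncate, extendedWeight], fun h => absurd trivial h⟩
  subst hcp
  -- One vertex remains: edges at `v₀` carry `w y`, the others `c`.
  have hwc : ∀ᵐ y, w y = c := by
    obtain ⟨x, hx⟩ := (ae_ae_update v₀ (hrel 1 (by omega))).exists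
    filter_upwards [hx] with y hy
    have h0 : truncate 1 (Function.update x v₀ y) v₀ = some y := by simp [truncate, v₀]
    have h1 : ∀ a, a ≠ v₀ → truncate 1 (Function.update x v₀ y) a = none := by
      intro a ha
      have : a.val ≠ 0 := fun h => ha (Fin.ext h)
      simp [truncate, this]
    refine key _ (w y) (fun σ e => v₀ ∈ e.map σ) hy (hwmem y).1 ?_ fun σ i j hij => ?_
    · simp [hσi]
    · have hσ : σ i ≠ σ j := σ.injective.ne hij
      simp only [Sym2.map_mk, Sym2.mem_iff]
      by_cases hi : σ i = v₀
      · have hj : σ j ≠ v₀ := fun hj => hσ (hi.trans hj.symm)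
        simp [hi, h0, h1 _ hj, extendedWeight]
      · by_cases hj : σ j = v₀
        · simp [hj, h0, h1 _ hi, extendedWeight]
        · simp [h1 _ hi, h1 _ hj, extendedWeight, Ne.symm hi, Ne.symm hj]
  -- Two vertices remain: edges to `∞` now carry `c` as well, leaving only the pair `v₀, v₁`
  -- unknown.
  have hpair : ∀ᵐ x : Fin m → unitInterval, W.toFun (x v₀) (x v₁) = c := by
    filter_upwards [hrel 2 hm, (Measure.quasiMeasurePreserving_eval _ v₀).ae hwc,
      (Measure.quasiMeasurePreserving_eval _ v₁).ae hwc] with x hx hx0 hx1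
    simp only [Function.eval] at hx0 hx1
    have h0 : truncate 2 x v₀ = some (x v₀) := by simp [truncate, v₀]
    have h1 : truncate 2 x v₁ = some (x v₁) := by simp [truncate, v₁]
    have h2 : ∀ a, a ≠ v₀ → a ≠ v₁ → truncate 2 x a = none := by
      intro a ha ha'
      have e0 : a.val ≠ 0 := fun h => ha (Fin.ext h)
      have e1 : a.val ≠ 1 := fun h => ha' (Fin.ext h)
      have : ¬ a.val < 2 := by omega
      simp [truncate, this]
    refine key _ _ (fun σ e => e.map σ = s(v₀, v₁)) hx (W.nonneg' _ _) ?_ fun σ i j hij => ?_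
    · simp [hσi, hσj]
    · have hσ : σ i ≠ σ j := σ.injective.ne hij
      simp only [Sym2.map_mk]
      by_cases hi : σ i = v₀
      · by_cases hj : σ j = v₁
        · simp [hi, hj, h0, h1, extendedWeight]
        · have hj0 : σ j ≠ v₀ := fun hj0 => hσ (hi.trans hj0.symm)
          simp [hi, hj, h0, h2 _ hj0 hj, extendedWeight, hx0, hv]
      · by_cases hi1 : σ i = v₁
        · by_cases hj : σ j = v₀
          · simp [hi1, hj, h0, h1, extendedWeight, W.symm' (x v₁), Sym2.eq_swap]
          · have hj1 : σ j ≠ v₁ := fun hj1 => hσ (hi1.trans hj1.symm)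
            simp [hi1, hj, h1, h2 _ hj hj1, extendedWeight, hx1, hv.symm]
        · have hne' : s(σ i, σ j) ≠ s(v₀, v₁) := by
            simp [hi, hi1]
          refine ⟨fun h => absurd h hne', fun _ => ?_⟩
          rw [h2 _ hi hi1]
          by_cases hj : σ j = v₀
          · simp [hj, h0, extendedWeight, hx0]
          · by_cases hj1 : σ j = v₁
            · simp [hj1, h1, extendedWeight, hx1]
            · simp [h2 _ hj hj1, extendedWeight]
  have hmp := measurePreserving_eval_pair hv
  have hset : MeasurableSet {z : unitInterval × unitInterval | W.toFun z.1 z.2 = c} :=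
    W.measurable' (measurableSet_singleton c)
  rw [Graphon.EqConst, ← hmp.map_eq]
  exact (ae_map_iff hmp.measurable.aemeasurable hset).2 hpair

end Rigidity

/-! ### Quasi-random properties -/

namespace Graphon

variable {m : ℕ} (W : Graphon) (F : SimpleGraph (Fin m)) [DecidableRel F.Adj]

theorem measurable_edgeProd : Measurable fun x : Fin m → unitInterval => W.edgeProd F x := by
  refine Finset.measurable_prod _ fun e _ => ?_
  induction e with
  | _ i j =>
    have hpair : Measurable fun x : Fin m → unitInterval => (x i, x j) :=
      (measurable_pi_apply i).prodMk (measurable_pi_apply j)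
    exact W.measurable'.comp hpair

theorem edgeProd_mem_Icc (x : Fin m → unitInterval) : W.edgeProd F x ∈ Set.Icc (0 : ℝ) 1 := by
  have h : ∀ e, W.edgeWeight x e ∈ Set.Icc (0 : ℝ) 1 := by
    intro e
    induction e with
    | _ i j => exact ⟨W.nonneg' _ _, W.le_one' _ _⟩
  exact ⟨Finset.prod_nonneg fun e _ => (h e).1,
    Finset.prod_le_one (fun e _ => (h e).1) fun e _ => (h e).2⟩

theorem abs_edgeProd_le_one (x : Fin m → unitInterval) : |W.edgeProd F x| ≤ 1 :=
  abs_le.2 ⟨by linarith [(W.edgeProd_mem_Icc F x).1], (W.edgeProd_mem_Icc F x).2⟩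

variable {W}

theorem EqConst.ae_edgeProd_eq {p : ℝ} (h : W.EqConst p) :
    ∀ᵐ x : Fin m → unitInterval, W.edgeProd F x = p ^ F.edgeFinset.card := by
  have h2 : ∀ᵐ x : Fin m → unitInterval, ∀ i j : Fin m, i ≠ j → W.toFun (x i) (x j) = p := by
    simp only [ae_all_iff]
    intro i j hij
    exact (measurePreserving_eval_pair hij).quasiMeasurePreserving.ae h
  filter_upwards [h2] with x hx
  refine Finset.prod_eq_pow_card fun e he => ?_
  rw [SimpleGraph.mem_edgeFinset] at he
  induction e with
  | _ i j => exact hx i j (F.ne_of_adj he)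

theorem EqConst.integral_box_eq {p : ℝ} (h : W.EqConst p) {α : Fin m → ℝ} (hα : ∀ i, 0 ≤ α i)
    {A : Fin m → Set unitInterval} (hA : IsDisjointFamily α A) (σ : Equiv.Perm (Fin m)) :
    ∫ x in Set.univ.pi (fun i => A (σ i)), W.edgeProd F x =
      p ^ F.edgeFinset.card * ∏ i, α i := by
  have hm : MeasurableSet (Set.univ.pi fun i => A (σ i)) :=
    MeasurableSet.univ_pi fun i => hA.measurableSet (σ i)
  rw [setIntegral_congr_ae hm ((h.ae_edgeProd_eq F).mono fun x hx _ => hx), setIntegral_const,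
    smul_eq_mul, mul_comm, Measure.real, volume_pi, Measure.pi_pi, ENNReal.toReal_prod]
  simp only [hA.measure_eq, ENNReal.toReal_ofReal (hα _)]
  rw [Equiv.prod_comp σ α]

theorem EqConst.satisfiesP {p : ℝ} (h : W.EqConst p) {α : Fin m → ℝ} (hα : ∀ i, 0 ≤ α i) :
    SatisfiesP F α p W := fun _ hA => h.integral_box_eq F hα hA (Equiv.refl _)

theorem EqConst.satisfiesPTilde {p : ℝ} (h : W.EqConst p) {α : Fin m → ℝ} (hα : ∀ i, 0 ≤ α i) :
    SatisfiesPTilde F α p W := by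
  intro A hA
  simp only [h.integral_box_eq F hα hA, Finset.sum_const, Finset.card_univ, Fintype.card_perm,
    Fintype.card_fin, nsmul_eq_mul]
  have : (m.factorial : ℝ) ≠ 0 := Nat.cast_ne_zero.2 m.factorial_ne_zero
  field_simp

end Graphon

section QuasiRandom

variable {m : ℕ} {F : SimpleGraph (Fin m)} [DecidableRel F.Adj] {p : ℝ} {α : Fin m → ℝ}
  {W : Graphon}

theorem integral_box_const (hα : ∀ i, 0 ≤ α i) {A : Fin m → Set unitInterval}
    (hA : IsDisjointFamily α A) (c : ℝ) : ∫ _ in Set.univ.pi A, c = c * ∏ i, α i := by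
  rw [setIntegral_const, smul_eq_mul, mul_comm, Measure.real, volume_pi, Measure.pi_pi,
    ENNReal.toReal_prod]
  simp only [hA.measure_eq, ENNReal.toReal_ofReal (hα _)]

theorem SatisfiesP.eqConst (h : SatisfiesP F α p W) (hF : F.edgeSet.Nonempty) (hp : 0 < p)
    (hα : ∀ i, 0 < α i) (hsum : ∑ i, α i < 1) : W.EqConst p := by
  have hmeas := W.measurable_edgeProd F
  have hint := integrable_of_bounded hmeas (W.abs_edgeProd_le_one F)
  have hae : ∀ᵐ x : Fin m → unitInterval, W.edgeProd F x - p ^ F.edgeFinset.card = 0 := by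
    refine ae_eq_zero_of_sum_lt_one (C := 1 + |p ^ F.edgeFinset.card|) (hmeas.sub_const _)
      (fun x => (abs_sub _ _).trans (add_le_add_left (W.abs_edgeProd_le_one F x) _)) hα hsum
      fun A hA => ?_
    rw [integral_sub hint.integrableOn (integrable_const _), h A hA,
      integral_box_const (fun i => (hα i).le) hA, sub_self]
  -- The unsymmetrized product is already constant, so each of its `m!` permuted copies is.
  refine eqConst_of_ae_sum_edgeProd_eq hp F hF ?_
  have hall : ∀ᵐ x : Fin m → unitInterval, ∀ σ : Equiv.Perm (Fin m),
      W.edgeProd F (fun i => x (σ i)) - p ^ F.edgeFinset.card = 0 :=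
    ae_all_iff.2 fun σ => (measurePreserving_comp_perm σ).quasiMeasurePreserving.ae hae
  filter_upwards [hall] with x hx
  simp only [sub_eq_zero] at hx
  simp [hx, Fintype.card_perm]

theorem SatisfiesPTilde.eqConst (h : SatisfiesPTilde F α p W) (hF : F.edgeSet.Nonempty)
    (hp : 0 < p) (hα : ∀ i, 0 < α i) (hsum : ∑ i, α i ≤ 1) (hne : α ≠ fun _ => 1 / (m : ℝ)) :
    W.EqConst p := by
  have hmeas' : ∀ σ : Equiv.Perm (Fin m),
      Measurable fun x : Fin m → unitInterval => W.edgeProd F fun i => x (σ i) := fun σ =>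
    (W.measurable_edgeProd F).comp (measurePreserving_comp_perm σ).measurable
  have hint' : ∀ σ : Equiv.Perm (Fin m),
      Integrable fun x : Fin m → unitInterval => W.edgeProd F fun i => x (σ i) := fun σ =>
    integrable_of_bounded (hmeas' σ) fun x => W.abs_edgeProd_le_one F _
  set c : ℝ := m.factorial * p ^ F.edgeFinset.card with hc
  set f : (Fin m → unitInterval) → ℝ := fun x =>
    (∑ σ : Equiv.Perm (Fin m), W.edgeProd F fun i => x (σ i)) - c with hf
  have hfm : Measurable f := (Finset.measurable_sum _ fun σ _ => hmeas' σ).sub_const _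
  have hfb : ∀ x, |f x| ≤ m.factorial + |c| := by
    intro x
    refine (abs_sub _ _).trans (add_le_add_left ?_ _)
    refine (Finset.abs_sum_le_sum_abs _ _).trans
      ((Finset.sum_le_sum fun σ _ => W.abs_edgeProd_le_one F _).trans_eq ?_)
    simp [Fintype.card_perm]
  have hfs : ∀ (σ : Equiv.Perm (Fin m)) x, f (fun i => x (σ i)) = f x := by
    intro σ x
    simp only [hf]
    congr 1
    exact Equiv.sum_comp (Equiv.mulLeft σ) fun τ : Equiv.Perm (Fin m) => W.edgeProd F fun i => x (τ i)
  have hbox : ∀ A, IsDisjointFamily α A → ∫ x in Set.univ.pi A, f x = 0 := by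
    intro A hA
    have h1 := h A hA
    have hfac : (m.factorial : ℝ) ≠ 0 := Nat.cast_ne_zero.2 m.factorial_ne_zero
    simp only [integral_box_comp_perm] at h1
    simp only [hf]
    rw [integral_sub (integrable_finsetSum _ fun σ _ => (hint' σ).integrableOn)
      (integrable_const _), integral_finsetSum _ fun σ _ => (hint' σ).integrableOn,
      integral_box_const (fun i => (hα i).le) hA, hc, mul_assoc, ← h1]
    field_simp
    ring
  have hae : ∀ᵐ x, f x = 0 := by
    rcases hsum.lt_or_eq with hlt | heq
    · exact ae_eq_zero_of_sum_lt_one hfm hfb hα hlt hbox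
    · obtain ⟨i, j, hij⟩ : ∃ i j, α i ≠ α j := by
        by_contra! hcon
        refine hne (funext fun i => ?_)
        have : ∑ k, α k = m * α i := by simp [hcon _ i]
        rw [heq] at this
        exact eq_one_div_of_mul_eq_one_right this.symm
      -- Halving `α i` brings the total below 1, which reduces to the case with room.
      refine ae_eq_zero_of_sum_lt_one hfm hfb (α := Function.update α i (α i / 2)) (fun k => ?_) ?_
        fun A hA => integral_box_eq_zero_of_half hfm hfb hfs hα heq hbox hij A hA
      · rcases eq_or_ne k i with rfl | hk
        · simpa using hα k
        · simpa [hk] using hα k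
      · rw [Finset.sum_update_of_mem (Finset.mem_univ i), ← Finset.erase_eq]
        have := Finset.add_sum_erase Finset.univ α (Finset.mem_univ i)
        linarith [hα i]
  exact eqConst_of_ae_sum_edgeProd_eq hp F hF (hae.mono fun x hx => sub_eq_zero.1 hx)

end QuasiRandom

theorem mainTheorem6 (m : ℕ) (F : SimpleGraph (Fin m)) [DecidableRel F.Adj]
    (hF : F.edgeSet.Nonempty) (p : ℝ) (hp0 : 0 < p) (hp1 : p ≤ 1)
    (α : Fin m → ℝ) (hα : ∀ i, 0 < α i) (hsum : ∑ i, α i ≤ 1) :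
    (α ≠ (fun _ => 1 / (m : ℝ)) → IsQuasiRandomPTilde F α p) ∧
      (∑ i, α i < 1 → IsQuasiRandomP F α p) :=
  ⟨fun hne _ => ⟨fun h => h.eqConst hF hp0 hα hsum hne,
      fun h => h.satisfiesPTilde F fun i => (hα i).le⟩,
    fun hlt _ => ⟨fun h => h.eqConst hF hp0 hα hlt, fun h => h.satisfiesP F fun i => (hα i).le⟩⟩
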